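/- Let $H\in(1/2,1)$ and let $B_H=(B_H(t))_{t\ge 0}$ be a fractional Brownian motion with Hurst index $H$ on a probability space $(\Omega,\mathcal F,P)$, i.e. a centered Gaussian process with $\mathrm{Cov}(B_H(s),B_H(t))=\frac12\left(s^{2H}+t^{2H}-|t-s|^{2H}\right)$. Put $X(t)=\mathbf 1(B_H(t)>0)$ for $t\ge 0$. Let $\varphi:[0,\infty)\to[0,\infty)$ be a continuous strictly increasing function with $\varphi([0,\infty))=[0,\infty)$, and set $\varphi(\infty)=\infty$. Then the following hold, where the suprema are taken over all $n$ and all partitions $0=t_0<t_1<\dots<t_n=1$. (1) Almost surely, $X$ has infinite $\varphi$-variation on $[0,1]$: $$\sup \sum_{i=1}^n\varphi\big(|X(t_i)-X(t_{i-1})|\big)=\infty\quad\text{a.s.}$$ (2) Let $L$ be a linear space of real random variables on $(\Omega,\mathcal F,P)$ (identified when they are a.s. equal) that contains $X(t)$ for all $t\in[0,1]$, and let $\|\cdot\|$ be a norm on $L$, possibly taking the value $\infty$, such that $\|\xi\|$ depends only on the distribution of $\xi$. Then $X$ has infinite $\varphi$-variation on $[0,1]$ with respect to $\|\cdot\|$: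 $$\sup \sum_{i=1}^n\varphi\big(\|X(t_i)-X(t_{i-1})\|\big)=\infty.$$ -/

import Mathlib

open MeasureTheory ProbabilityTheory
open scoped NNReal ENNReal

/-- `B = (B t)_{t ≥ 0}` is a (standard) fractional Brownian motion with Hurst index `H` under `P`:
a centered Gaussian process with covariance `(s ^ (2H) + t ^ (2H) - |t - s| ^ (2H)) / 2`.
No regularity of the paths is required. -/
structure IsFractionalBrownianMotion {Ω : Type*} [MeasurableSpace Ω]
    (H : ℝ) (B : ℝ≥0 → Ω → ℝ) (P : Measure Ω) : Prop where
  isGaussianProcess : IsGaussianProcess B P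
  mean_eq_zero : ∀ t : ℝ≥0, ∫ ω, B t ω ∂P = 0
  covariance_eq : ∀ s t : ℝ≥0,
    covariance (B s) (B t) P =
      ((s : ℝ) ^ (2 * H) + (t : ℝ) ^ (2 * H) - |(t : ℝ) - (s : ℝ)| ^ (2 * H)) / 2

/-- The class of continuous strictly increasing functions `φ` on `[0, ∞)` whose range
is `[0, ∞)`. -/
def VariationClass : Set (ℝ≥0 → ℝ≥0) :=
  {φ | Continuous φ ∧ StrictMono φ ∧ Set.range φ = Set.univ}

/-- The extension of `φ` from `[0, ∞)` to `[0, ∞]` by `φ(∞) = ∞`. -/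
noncomputable def extendTop (φ : ℝ≥0 → ℝ≥0) (x : ℝ≥0∞) : ℝ≥0∞ :=
  if x = ∞ then ∞ else (φ x.toNNReal : ℝ≥0∞)

/-- `t` is a partition `a = t 0 < t 1 < ... < t n = b`. -/
def IsPartition (a b : ℝ≥0) (n : ℕ) (t : Fin (n + 1) → ℝ≥0) : Prop :=
  StrictMono t ∧ t 0 = a ∧ t (Fin.last n) = b

/-- The `φ`-variation on `[a, b]` of a real function `f`: the supremum over all partitions
of `∑ φ(|f(t_i) - f(t_{i-1})|)`. -/
noncomputable def phiVariation (φ : ℝ≥0 → ℝ≥0) (f : ℝ≥0 → ℝ) (a b : ℝ≥0) : ℝ≥0∞ :=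
  ⨆ (n : ℕ) (t : Fin (n + 1) → ℝ≥0) (_ : IsPartition a b n t),
    ∑ i : Fin n, (φ ‖f (t i.succ) - f (t i.castSucc)‖₊ : ℝ≥0∞)

/-- The `φ`-variation on `[a, b]` of a process `X` with respect to a functional `N` on random
variables: the supremum over all partitions of `∑ φ(N(X(t_i) - X(t_{i-1})))`. -/
noncomputable def phiVariationIn {Ω : Type*} (φ : ℝ≥0 → ℝ≥0) (N : (Ω → ℝ) → ℝ≥0∞)
    (X : ℝ≥0 → Ω → ℝ) (a b : ℝ≥0) : ℝ≥0∞ :=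
  ⨆ (n : ℕ) (t : Fin (n + 1) → ℝ≥0) (_ : IsPartition a b n t),
    ∑ i : Fin n, extendTop φ (N (X (t i.succ) - X (t i.castSucc)))

/-- `N` is a norm on the linear space `L` of real random variables (identified when they are
a.s. equal), and the norm of a random variable depends only on its distribution. The value `∞`
is allowed, so that, for instance, an `L_p`-norm may be considered on all random variables.
The values of `N` outside `L` are irrelevant. -/
structure IsLawInvariantNorm {Ω : Type*} [MeasurableSpace Ω] (P : Measure Ω)
    (L : Submodule ℝ (Ω → ℝ)) (N : (Ω → ℝ) → ℝ≥0∞) : Prop where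
  aemeasurable : ∀ ξ ∈ L, AEMeasurable ξ P
  eq_zero_iff : ∀ ξ ∈ L, N ξ = 0 ↔ ξ =ᵐ[P] 0
  smul_eq : ∀ (c : ℝ), ∀ ξ ∈ L, N (c • ξ) = ‖c‖ₑ * N ξ
  add_le : ∀ ξ ∈ L, ∀ η ∈ L, N (ξ + η) ≤ N ξ + N η
  eq_of_identDistrib : ∀ ξ ∈ L, ∀ η ∈ L, IdentDistrib ξ η P P → N ξ = N η

/-- The process `X(t) = 1(B(t) > 0)`. -/
noncomputable def positivityProcess {Ω : Type*} (B : ℝ≥0 → Ω → ℝ) (t : ℝ≥0) (ω : Ω) : ℝ :=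
  Set.indicator {x : ℝ | 0 < x} (fun _ => (1 : ℝ)) (B t ω)

/-!
Along the times `2⁻ᵏ`, the rescaled process `Z k = 2 ^ (H k) * B (2⁻ᵏ)` has the same signs as `B`,
and self-similarity makes it a stationary centered Gaussian sequence. Its correlation at lag `m` is
`r ^ (-H) * (1 + r ^ (2H) - (1 - r) ^ (2H)) / 2` with `r = 2⁻ᵐ`, which tends to `0` as `m → ∞`
(by Bernoulli's inequality it is at most `H r ^ (1 - H) + r ^ H / 2`).

Almost surely, the signs of `Z` change infinitely often (`ae_infinite_sign_changes`). Indeed, for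
widely spaced indices the events `{Z i > 0}` have probability `1/2` and are almost pairwise
independent (`exists_pos_forall_measureReal_orthant_le`), so by a second moment estimate
(`measureReal_all_signs_eq_le`) `d` of these signs agree with probability at most `1 / d + ε`; hence the
signs of `Z` are almost surely not eventually constant. Each sign change along `2⁻ᵏ` contributes
`φ 1 > 0` to the `φ`-variation, which proves the statement on paths. Only countably many times are
involved, so no regularity of the paths is needed.

For a law-invariant norm, the pairs `(Z k, Z (k + 1))` all have the same law, so the increments of
`X = 1(B > 0)` along `2⁻ᵏ` all have the same norm. It is not zero, since otherwise
there would be no sign change along `2⁻ᵏ`. Thus the partition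
`0 < 2⁻ⁿ < ... < 1/2 < 1` gives a sum that contains `n` equal positive terms.
-/

open Filter Topology

/-! ### The standard Gaussian measure on half-lines -/

theorem gaussianReal_real_Ioi_zero : (gaussianReal 0 1).real (Set.Ioi 0) = 1 / 2 := by
  have : NullSingletonClass (gaussianReal 0 1) := nullSingletonClass_gaussianReal one_ne_zero
  have h1 : (gaussianReal 0 1).real (Set.Iio 0) = (gaussianReal 0 1).real (Set.Ioi 0) := by
    have h := gaussianReal_map_neg (μ := 0) (v := 1)
    rw [neg_zero] at h
    conv_rhs => rw [← h]
    rw [map_measureReal_apply measurable_neg measurableSet_Ioi]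
    congr 1
    ext x
    simp
  have h2 : (gaussianReal 0 1).real (Set.Iic 0) = (gaussianReal 0 1).real (Set.Iio 0) :=
    measureReal_congr Iio_ae_eq_Iic.symm
  have h3 := probReal_compl_eq_one_sub (μ := gaussianReal 0 1) (s := Set.Ioi (0 : ℝ))
    measurableSet_Ioi
  rw [Set.compl_Ioi] at h3
  linarith

theorem exists_pos_gaussianReal_real_Ioi_neg_lt {η : ℝ} (hη : 0 < η) :
    ∃ δ > 0, (gaussianReal 0 1).real (Set.Ioi (-δ)) < 1 / 2 + η := by
  have : NullSingletonClass (gaussianReal 0 1) := nullSingletonClass_gaussianReal one_ne_zero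
  have hI : ⋂ n : ℕ, Set.Ioi (-(1 / ((n : ℝ) + 1))) = Set.Ici 0 := by
    ext x
    simp only [Set.mem_iInter, Set.mem_Ioi, Set.mem_Ici]
    constructor
    · intro h
      have ht := (tendsto_one_div_add_atTop_nhds_zero_nat (𝕜 := ℝ)).neg
      rw [neg_zero] at ht
      exact le_of_tendsto' ht fun n => (h n).le
    · intro h n
      have : 0 < 1 / ((n : ℝ) + 1) := by positivity
      linarith
  have ht : Tendsto (fun n : ℕ => gaussianReal 0 1 (Set.Ioi (-(1 / ((n : ℝ) + 1))))) atTop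
      (𝓝 (gaussianReal 0 1 (Set.Ici 0))) := by
    rw [← hI]
    refine tendsto_measure_iInter_atTop (fun n => measurableSet_Ioi.nullMeasurableSet) ?_
      ⟨0, measure_ne_top _ _⟩
    intro m n hmn
    exact Set.Ioi_subset_Ioi (neg_le_neg (one_div_le_one_div_of_le (by positivity)
      (by gcongr)))
  have ht' := (ENNReal.tendsto_toReal (measure_ne_top _ _)).comp ht
  have hval : (gaussianReal 0 1).real (Set.Ici 0) = 1 / 2 := by
    rw [← gaussianReal_real_Ioi_zero]
    exact measureReal_congr Ioi_ae_eq_Ici.symm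
  obtain ⟨n, hn⟩ := (ht'.eventually_lt_const (u := 1 / 2 + η)
    (by change (gaussianReal 0 1).real (Set.Ici 0) < _; linarith)).exists
  exact ⟨1 / ((n : ℝ) + 1), by positivity, hn⟩

/-! ### Pairs of jointly Gaussian variables -/

section

variable {Ω : Type*} [MeasurableSpace Ω] {P : Measure Ω}

theorem hasLaw_gaussianReal_zero_one {U : Ω → ℝ} (hU : HasGaussianLaw U P)
    (hm : ∫ ω, U ω ∂P = 0) (hv : cov[U, U; P] = 1) : HasLaw U (gaussianReal 0 1) P where
  aemeasurable := hU.aemeasurable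
  map_eq := by
    rw [covariance_self hU.aemeasurable] at hv
    rw [hU.map_eq_gaussianReal, hm, hv]
    simp

theorem measureReal_pos_eq_half {U : Ω → ℝ} (hU : HasLaw U (gaussianReal 0 1) P) :
    P.real {ω | 0 < U ω} = 1 / 2 := by
  rw [← gaussianReal_real_Ioi_zero, ← hU.map_eq, measureReal_def, measureReal_def,
    Measure.map_apply_of_aemeasurable hU.aemeasurable measurableSet_Ioi]
  rfl

/-- The probability that two jointly Gaussian standard normal variables are both positive exceeds
`1/4` arbitrarily little once their correlation is small. This needs no density: `V` and its part
`V - ρ U` independent of `U` differ by `ρ U`, which is small with high probability, and the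
standard Gaussian measure has no atom at `0`. -/
theorem exists_pos_forall_measureReal_orthant_le {η : ℝ} (hη : 0 < η) :
    ∃ ρ > 0, ∀ U V : Ω → ℝ, HasGaussianLaw (fun ω => (U ω, V ω)) P →
      ∫ ω, U ω ∂P = 0 → ∫ ω, V ω ∂P = 0 → cov[U, U; P] = 1 → cov[V, V; P] = 1 →
      |cov[U, V; P]| ≤ ρ → P.real {ω | 0 < U ω ∧ 0 < V ω} ≤ 1 / 4 + η := by
  obtain ⟨δ, hδ, hδη⟩ := exists_pos_gaussianReal_real_Ioi_neg_lt hη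
  set ε := δ / 2 with hε
  have hε0 : 0 < ε := by positivity
  refine ⟨min 1 (ε ^ 2 * (η / 4)), by positivity, fun U V hUV hmU hmV hvU hvV hc => ?_⟩
  have := hUV.isProbabilityMeasure
  set ρ := cov[U, V; P] with hρ
  have hlawU := hasLaw_gaussianReal_zero_one hUV.fst hmU hvU
  have hlawV := hasLaw_gaussianReal_zero_one hUV.snd hmV hvV
  -- the part of `V` that is independent of `U`
  set W : Ω → ℝ := fun ω => V ω - ρ * U ω with hW
  have hUW : IndepFun U W P := by
    apply HasGaussianLaw.indepFun_of_covariance_eq_zero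
    · exact hUV.map ((ContinuousLinearMap.fst ℝ ℝ ℝ).prod
        (ContinuousLinearMap.snd ℝ ℝ ℝ - ρ • ContinuousLinearMap.fst ℝ ℝ ℝ))
    · rw [hW, covariance_fun_sub_right hUV.fst.memLp_two hUV.snd.memLp_two
        (hUV.fst.memLp_two.const_mul _), covariance_const_mul_right, hvU]
      simp [hρ]
  -- Chebyshev's inequality for `ρ U`
  set Q := P.real {ω | ε ≤ |ρ * U ω|} with hQ
  have hQle : Q ≤ η / 4 := by
    have hch := meas_ge_le_variance_div_sq (hUV.fst.memLp_two.const_mul ρ) hε0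
    have hvar : Var[fun ω => ρ * U ω; P] = ρ ^ 2 := by
      rw [variance_const_mul, ← covariance_self hUV.fst.aemeasurable, hvU, mul_one]
    rw [hvar] at hch
    have hmean : ∫ ω, ρ * U ω ∂P = 0 := by rw [integral_const_mul, hmU, mul_zero]
    simp only [hmean, sub_zero] at hch
    have h1 : Q ≤ ρ ^ 2 / ε ^ 2 := ENNReal.toReal_le_of_le_ofReal (by positivity) hch
    refine h1.trans ?_
    rw [div_le_iff₀ (by positivity), ← sq_abs]
    have h2 := hc.trans (min_le_left _ _)
    have h3 := hc.trans (min_le_right _ _)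
    nlinarith [abs_nonneg ρ]
  have h1 : P.real {ω | 0 < U ω ∧ 0 < V ω} ≤ P.real {ω | 0 < U ω ∧ -ε < W ω} + Q := by
    refine (measureReal_mono ?_).trans (measureReal_union_le _ _)
    rintro ω ⟨hu, hv⟩
    by_cases h : ε ≤ |ρ * U ω|
    · exact Or.inr h
    · refine Or.inl ⟨hu, ?_⟩
      have := (abs_lt.1 (not_le.1 h)).2
      simp only [hW]
      linarith
  have h2 : P.real {ω | -ε < W ω} ≤ P.real {ω | -δ < V ω} + Q := by
    refine (measureReal_mono ?_).trans (measureReal_union_le _ _)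
    intro ω hw
    by_cases h : ε ≤ |ρ * U ω|
    · exact Or.inr h
    · refine Or.inl ?_
      have := (abs_lt.1 (not_le.1 h)).1
      simp only [hW, Set.mem_ofPred_eq] at hw ⊢
      linarith
  have h3 : P.real {ω | 0 < U ω ∧ -ε < W ω} = 1 / 2 * P.real {ω | -ε < W ω} := by
    have := hUW.measure_inter_preimage_eq_mul _ _ (measurableSet_Ioi (a := (0 : ℝ)))
      (measurableSet_Ioi (a := -ε))
    rw [← measureReal_pos_eq_half hlawU, measureReal_def, measureReal_def, measureReal_def,
      ← ENNReal.toReal_mul]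
    exact congrArg ENNReal.toReal this
  have h4 : P.real {ω | -δ < V ω} < 1 / 2 + η := by
    rw [← hlawV.map_eq, measureReal_def,
      Measure.map_apply_of_aemeasurable hlawV.aemeasurable measurableSet_Ioi] at hδη
    exact hδη
  linarith

/-- The law of a Gaussian pair is determined by its means and covariances. -/
theorem map_prodMk_eq_of_covariance_eq {U V U' V' : Ω → ℝ}
    (hUV : HasGaussianLaw (fun ω => (U ω, V ω)) P)
    (hUV' : HasGaussianLaw (fun ω => (U' ω, V' ω)) P)
    (hU : ∫ ω, U ω ∂P = ∫ ω, U' ω ∂P) (hV : ∫ ω, V ω ∂P = ∫ ω, V' ω ∂P)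
    (hUU : cov[U, U; P] = cov[U', U'; P]) (hUVc : cov[U, V; P] = cov[U', V'; P])
    (hVV : cov[V, V; P] = cov[V', V'; P]) :
    P.map (fun ω => (U ω, V ω)) = P.map (fun ω => (U' ω, V' ω)) := by
  have := hUV.isProbabilityMeasure
  have := hUV.isGaussian_map
  have := hUV'.isGaussian_map
  apply Measure.ext_of_charFunDual
  ext L
  have hL (x y : ℝ) : L (x, y) = L (1, 0) * x + L (0, 1) * y := by
    have : (x, y) = x • ((1 : ℝ), (0 : ℝ)) + y • ((0 : ℝ), (1 : ℝ)) := by simp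
    rw [this, map_add, map_smul, map_smul, smul_eq_mul, smul_eq_mul]
    ring
  -- the characteristic function at `L` depends only on the mean and variance of `a U + b V`
  set a := L (1, 0)
  set b := L (0, 1)
  have key (X Y : Ω → ℝ) (h : HasGaussianLaw (fun ω => (X ω, Y ω)) P) :
      charFunDual (P.map (fun ω => (X ω, Y ω))) L =
        Complex.exp (((a * ∫ ω, X ω ∂P + b * ∫ ω, Y ω ∂P : ℝ) : ℂ) * Complex.I -
          ((a ^ 2 * cov[X, X; P] + 2 * a * b * cov[X, Y; P] + b ^ 2 * cov[Y, Y; P] : ℝ) : ℂ)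
            / 2) := by
    have hX := h.fst.memLp_two.const_mul a
    have hY := h.snd.memLp_two.const_mul b
    rw [h.charFunDual_map_eq_fun]
    simp only [hL]
    rw [integral_add (h.fst.integrable.const_mul a) (h.snd.integrable.const_mul b),
      integral_const_mul, integral_const_mul, variance_fun_add hX hY,
      covariance_const_mul_left, covariance_const_mul_right, variance_const_mul,
      variance_const_mul, ← covariance_self h.fst.aemeasurable,
      ← covariance_self h.snd.aemeasurable]
    congr 4
    ring
  rw [key U V hUV, key U' V' hUV', hU, hV, hUU, hUVc, hVV]

/-! ### Sign changes of a Gaussian sequence -/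

/-- If `d` events of probability `1/2` have pairwise intersections of probability at most
`1/4 + η`, then with probability at least `1 - (1 / d + 4 η)` some but not all of them occur. The
sum of the corresponding `±1`-valued variables has second moment at most `d + 4 η d²`, and its
square is `d²` when they all agree. -/
theorem measureReal_all_signs_eq_le [IsProbabilityMeasure P] {d : ℕ} (hd : 0 < d) {η : ℝ}
    (hη : 0 ≤ η) {f : ℕ → Ω → ℝ} (hf : ∀ i, AEMeasurable (f i) P)
    (hhalf : ∀ i < d, P.real {ω | 0 < f i ω} = 1 / 2)
    (hpair : ∀ i < d, ∀ j < d, i ≠ j → P.real {ω | 0 < f i ω ∧ 0 < f j ω} ≤ 1 / 4 + η) :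
    P.real {ω | ∀ i < d, (0 < f i ω ↔ 0 < f 0 ω)} ≤ 1 / d + 4 * η := by
  set s : ℕ → Ω → ℝ := fun i ω => 2 * {ω | 0 < f i ω}.indicator (fun _ => 1) ω - 1 with hs
  have hnull (i : ℕ) : NullMeasurableSet {ω | 0 < f i ω} P :=
    (hf i).nullMeasurableSet_preimage measurableSet_Ioi
  have hprod (i j : ℕ) : (fun ω => s i ω * s j ω) = fun ω =>
      4 * {ω | 0 < f i ω ∧ 0 < f j ω}.indicator (fun _ => (1 : ℝ)) ω
        - 2 * {ω | 0 < f i ω}.indicator (fun _ => 1) ω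
        - 2 * {ω | 0 < f j ω}.indicator (fun _ => 1) ω + 1 := by
    ext ω
    by_cases h1 : 0 < f i ω <;> by_cases h2 : 0 < f j ω <;> simp [hs, h1, h2] <;> norm_num
  have hind (A : Set Ω) (hA : NullMeasurableSet A P) (c : ℝ) :
      Integrable (fun ω => c * A.indicator (fun _ => (1 : ℝ)) ω) P :=
    ((integrable_const (1 : ℝ)).indicator₀ hA).const_mul c
  have hint (i j : ℕ) : Integrable (fun ω => s i ω * s j ω) P := by
    rw [hprod]
    exact (((hind _ ((hnull i).inter (hnull j)) _).sub (hind _ (hnull i) _)).sub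
      (hind _ (hnull j) _)).add (integrable_const 1)
  have hival (A : Set Ω) (hA : NullMeasurableSet A P) :
      ∫ ω, A.indicator (fun _ => (1 : ℝ)) ω ∂P = P.real A := by
    rw [integral_indicator₀ hA]
    simp
  have hcov (i j : ℕ) (hi : i < d) (hj : j < d) :
      ∫ ω, s i ω * s j ω ∂P = 4 * P.real {ω | 0 < f i ω ∧ 0 < f j ω} - 1 := by
    have hij : NullMeasurableSet {ω | 0 < f i ω ∧ 0 < f j ω} P := (hnull i).inter (hnull j)
    have h1 : Integrable (fun ω => 4 * {ω | 0 < f i ω ∧ 0 < f j ω}.indicator (fun _ => (1 : ℝ)) ω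
        - 2 * {ω | 0 < f i ω}.indicator (fun _ => 1) ω) P :=
      (hind _ hij _).sub (hind _ (hnull i) _)
    have h2 : Integrable (fun ω => 4 * {ω | 0 < f i ω ∧ 0 < f j ω}.indicator (fun _ => (1 : ℝ)) ω
        - 2 * {ω | 0 < f i ω}.indicator (fun _ => 1) ω
        - 2 * {ω | 0 < f j ω}.indicator (fun _ => 1) ω) P :=
      h1.sub (hind _ (hnull j) _)
    rw [hprod, integral_add h2 (integrable_const 1), integral_sub h1 (hind _ (hnull j) _),
      integral_sub (hind _ hij _) (hind _ (hnull i) _),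
      integral_const_mul, integral_const_mul, integral_const_mul, hival _ hij,
      hival _ (hnull i), hival _ (hnull j), hhalf i hi, hhalf j hj]
    simp
  have hle : ∀ i < d, ∀ j < d, ∫ ω, s i ω * s j ω ∂P ≤ 4 * η + if i = j then 1 else 0 := by
    intro i hi j hj
    rw [hcov i j hi hj]
    split_ifs with h
    · subst h
      simp only [and_self, hhalf i hi]
      linarith
    · have := hpair i hi j hj h
      linarith
  have hS : ∫ ω, (∑ i ∈ Finset.range d, s i ω) ^ 2 ∂P ≤ d ^ 2 * (4 * η) + d := by
    simp only [sq, Finset.sum_mul_sum]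
    rw [integral_finsetSum _ fun i _ => integrable_finsetSum _ fun j _ => hint i j]
    simp_rw [integral_finsetSum _ fun j _ => hint _ j]
    refine (Finset.sum_le_sum fun i hi => Finset.sum_le_sum fun j hj =>
      hle i (Finset.mem_range.1 hi) j (Finset.mem_range.1 hj)).trans (le_of_eq ?_)
    have (i : ℕ) (hi : i ∈ Finset.range d) : ∑ j ∈ Finset.range d,
        (4 * η + if i = j then 1 else 0) = d * (4 * η) + 1 := by
      rw [Finset.sum_add_distrib, Finset.sum_ite_eq, if_pos hi]
      simp
    rw [Finset.sum_congr rfl this]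
    simp
    ring
  have hmarkov := mul_meas_ge_le_integral_of_nonneg (μ := P)
    (f := fun ω => (∑ i ∈ Finset.range d, s i ω) ^ 2) (ae_of_all _ fun ω => sq_nonneg _)
    (by
      simp only [sq, Finset.sum_mul_sum]
      exact integrable_finsetSum _ fun i _ => integrable_finsetSum _ fun j _ => hint i j)
    ((d : ℝ) ^ 2)
  have hsub : {ω | ∀ i < d, (0 < f i ω ↔ 0 < f 0 ω)} ⊆
      {ω | (d : ℝ) ^ 2 ≤ (∑ i ∈ Finset.range d, s i ω) ^ 2} := by
    intro ω hω
    have : ∑ i ∈ Finset.range d, s i ω = d * s 0 ω := by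
      rw [Finset.sum_congr rfl (g := fun _ => s 0 ω)]
      · simp
      · intro i hi
        simp only [hs, Set.indicator, Set.mem_ofPred_eq, hω i (Finset.mem_range.1 hi)]
    have h0 : s 0 ω ^ 2 = 1 := by
      by_cases h : 0 < f 0 ω <;> simp [hs, h]
      norm_num
    simp only [Set.mem_ofPred_eq]
    rw [this, mul_pow, h0, mul_one]
  have hd' : (0 : ℝ) < d := by exact_mod_cast hd
  have hmono := measureReal_mono (μ := P) hsub
  have hlt : (d : ℝ) ^ 2 * P.real {ω | ∀ i < d, (0 < f i ω ↔ 0 < f 0 ω)}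
      ≤ d ^ 2 * (4 * η) + d :=
    (mul_le_mul_of_nonneg_left hmono (by positivity)).trans (hmarkov.trans hS)
  refine le_of_mul_le_mul_left (hlt.trans (le_of_eq ?_)) (by positivity : (0 : ℝ) < (d : ℝ) ^ 2)
  field_simp
  ring

end

section

variable {Ω : Type*} [MeasurableSpace Ω] {P : Measure Ω}

/-- A stationary centered Gaussian sequence whose correlation tends to `0` almost surely changes
sign infinitely often. -/
theorem ae_infinite_sign_changes {Z : ℕ → Ω → ℝ} (hZ : IsGaussianProcess Z P)
    (hmean : ∀ k, ∫ ω, Z k ω ∂P = 0) {c : ℕ → ℝ} (hcov : ∀ j m, cov[Z j, Z (j + m); P] = c m)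
    (hc0 : c 0 = 1) (hc : Tendsto c atTop (𝓝 0)) :
    ∀ᵐ ω ∂P, {k | ¬ (0 < Z k ω ↔ 0 < Z (k + 1) ω)}.Infinite := by
  have := hZ.isProbabilityMeasure
  have hvar (k : ℕ) : cov[Z k, Z k; P] = 1 := by
    have := hcov k 0
    rwa [add_zero, hc0] at this
  have hK (K : ℕ) : P {ω | ∀ k, 0 < Z (K + k) ω ↔ 0 < Z K ω} = 0 := by
    rw [← measureReal_eq_zero_iff]
    refine le_antisymm (le_of_forall_pos_le_add fun ε hε => ?_) measureReal_nonneg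
    obtain ⟨ρ, hρ, hpair⟩ := exists_pos_forall_measureReal_orthant_le (P := P)
      (η := ε / 8) (by positivity)
    -- the indices `K + i * (m + 1)`, `i ≤ n`, are spaced so widely that the correlations are at
    -- most `ρ`
    obtain ⟨m, hm⟩ := eventually_atTop.1 (hc.eventually (Metric.closedBall_mem_nhds 0 hρ))
    obtain ⟨n, hn⟩ := exists_nat_one_div_lt (half_pos hε)
    have hcovle (i j : ℕ) (hij : i < j) :
        |cov[Z (K + i * (m + 1)), Z (K + j * (m + 1)); P]| ≤ ρ := by
      obtain ⟨a, rfl⟩ := Nat.exists_eq_add_of_lt hij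
      rw [show K + (i + a + 1) * (m + 1) = K + i * (m + 1) + (a + 1) * (m + 1) by ring, hcov]
      simpa using hm ((a + 1) * (m + 1)) (by nlinarith)
    have h := measureReal_all_signs_eq_le (P := P) (Nat.succ_pos n) (η := ε / 8) (by positivity)
      (f := fun i => Z (K + i * (m + 1))) (fun i => hZ.aemeasurable _)
      (fun i _ => measureReal_pos_eq_half
        (hasLaw_gaussianReal_zero_one (hZ.hasGaussianLaw_eval _) (hmean _) (hvar _)))
      (fun i _ j _ hij => hpair _ _ hZ.hasGaussianLaw_prodMk (hmean _) (hmean _) (hvar _)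
        (hvar _) (by
          rcases hij.lt_or_gt with h | h
          · exact hcovle i j h
          · rw [covariance_comm]
            exact hcovle j i h))
    have hsub := measureReal_mono (μ := P) (s₁ := {ω | ∀ k, 0 < Z (K + k) ω ↔ 0 < Z K ω})
      (s₂ := {ω | ∀ i < n.succ, (0 < Z (K + i * (m + 1)) ω ↔ 0 < Z (K + 0 * (m + 1)) ω)})
      (fun ω hω i _ => by simpa using hω (i * (m + 1)))
    push_cast at h
    linarith
  have hall : ∀ᵐ ω ∂P, ∀ K, ¬ ∀ k, (0 < Z (K + k) ω ↔ 0 < Z K ω) :=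
    ae_all_iff.2 fun K => by
      rw [ae_iff]
      simpa using hK K
  filter_upwards [hall] with ω hω hfin
  obtain ⟨K, hKb⟩ := hfin.bddAbove
  -- beyond the last sign change the sign is constant
  refine hω (K + 1) fun k => ?_
  induction k with
  | zero => rfl
  | succ k ih =>
    rw [← ih]
    by_contra hne
    have : K + 1 + k ≤ K := hKb (fun h => hne h.symm)
    omega

end

/-! ### Fractional Brownian motion along dyadic times -/

/-- The correlation of the values of a fractional Brownian motion with Hurst index `H` at two times
whose ratio is `r ∈ (0, 1]`. -/
noncomputable def fbmCorrelation (H r : ℝ) : ℝ :=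
  r ^ (-H) * (1 + r ^ (2 * H) - (1 - r) ^ (2 * H)) / 2

theorem fbmCorrelation_one {H : ℝ} (hH : 0 < H) : fbmCorrelation H 1 = 1 := by
  rw [fbmCorrelation, sub_self, Real.zero_rpow (by positivity)]
  simp

/-- The covariance of `s ^ (-H) * B s` and `(s * r) ^ (-H) * B (s * r)`, where `B` is a fractional
Brownian motion, depends on `r` only. -/
theorem rescaled_covariance_eq {H s r : ℝ} (hs : 0 < s) (hr : 0 < r) (hr1 : r ≤ 1) :
    s ^ (-H) * ((s * r) ^ (-H) *
      ((s ^ (2 * H) + (s * r) ^ (2 * H) - |s * r - s| ^ (2 * H)) / 2)) = fbmCorrelation H r := by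
  have h1 : |s * r - s| = s * (1 - r) := by
    rw [abs_of_nonpos (by nlinarith)]
    ring
  have h2 : s ^ (-H) * s ^ (-H) * s ^ (2 * H) = 1 := by
    rw [← Real.rpow_add hs, ← Real.rpow_add hs, show -H + -H + 2 * H = 0 by ring, Real.rpow_zero]
  rw [h1, Real.mul_rpow hs.le hr.le, Real.mul_rpow hs.le hr.le,
    Real.mul_rpow hs.le (by linarith), fbmCorrelation]
  linear_combination (r ^ (-H) * (1 + r ^ (2 * H) - (1 - r) ^ (2 * H)) / 2) * h2

theorem tendsto_fbmCorrelation_zero {H : ℝ} (hH : H ∈ Set.Ioo (1 / 2 : ℝ) 1) :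
    Tendsto (fbmCorrelation H) (𝓝[>] 0) (𝓝 0) := by
  obtain ⟨hH1, hH2⟩ := hH
  have hbound : Tendsto (fun r : ℝ => H * r ^ (1 - H) + r ^ H / 2) (𝓝[>] 0) (𝓝 0) := by
    have hcont : Continuous fun r : ℝ => H * r ^ (1 - H) + r ^ H / 2 := by
      have h1 := Real.continuous_rpow_const (q := 1 - H) (by linarith)
      have h2 := Real.continuous_rpow_const (q := H) (by linarith)
      fun_prop
    have := hcont.tendsto 0
    rw [Real.zero_rpow (by linarith), Real.zero_rpow (by linarith)] at this
    simp only [mul_zero, zero_div, add_zero] at this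
    exact this.mono_left nhdsWithin_le_nhds
  have hmem : ∀ᶠ r : ℝ in 𝓝[>] 0, r ∈ Set.Ioo (0 : ℝ) 1 := Ioo_mem_nhdsGT one_pos
  refine squeeze_zero' ?_ ?_ hbound
  · filter_upwards [hmem] with r ⟨hr0, hr1⟩
    have h1 : (1 - r) ^ (2 * H) ≤ 1 :=
      Real.rpow_le_one (by linarith) (by linarith) (by linarith)
    have h2 : 0 ≤ r ^ (2 * H) := by positivity
    have h3 : 0 ≤ r ^ (-H) := by positivity
    unfold fbmCorrelation
    have := mul_nonneg h3 (by linarith : 0 ≤ 1 + r ^ (2 * H) - (1 - r) ^ (2 * H))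
    linarith
  · filter_upwards [hmem] with r ⟨hr0, hr1⟩
    have h1 := one_add_mul_self_le_rpow_one_add (s := -r) (by linarith) (p := 2 * H) (by linarith)
    rw [← sub_eq_add_neg] at h1
    have h3 : 0 ≤ r ^ (-H) := by positivity
    have h4 : r ^ (-H) * r = r ^ (1 - H) := by
      rw [← Real.rpow_add_one hr0.ne']
      ring_nf
    have h5 : r ^ (-H) * r ^ (2 * H) = r ^ H := by
      rw [← Real.rpow_add hr0]
      ring_nf
    have h6 := mul_le_mul_of_nonneg_left
      (by linarith : 1 + r ^ (2 * H) - (1 - r) ^ (2 * H) ≤ 2 * H * r + r ^ (2 * H)) h3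
    rw [← h4, ← h5]
    unfold fbmCorrelation
    linarith

/-- The time `2⁻ᵏ`. -/
noncomputable def dyadicTime (k : ℕ) : ℝ≥0 := 2⁻¹ ^ k

theorem coe_dyadicTime_pos (k : ℕ) : 0 < (dyadicTime k : ℝ) := by
  unfold dyadicTime
  positivity

theorem dyadicTime_le_one (k : ℕ) : dyadicTime k ≤ 1 :=
  pow_le_one₀ (by positivity) (by norm_num)

/-- The values of `B` at the times `2⁻ᵏ`, divided by `(2⁻ᵏ) ^ H`: the Lamperti transform of `B`
sampled at integer times. -/
noncomputable def lamperti {Ω : Type*} (H : ℝ) (B : ℝ≥0 → Ω → ℝ) (k : ℕ) (ω : Ω) : ℝ :=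
  (dyadicTime k : ℝ) ^ (-H) * B (dyadicTime k) ω

theorem lamperti_pos_iff {Ω : Type*} (H : ℝ) (B : ℝ≥0 → Ω → ℝ) (k : ℕ) (ω : Ω) :
    0 < lamperti H B k ω ↔ 0 < B (dyadicTime k) ω :=
  mul_pos_iff_of_pos_left (Real.rpow_pos_of_pos (coe_dyadicTime_pos k) _)

namespace IsFractionalBrownianMotion

variable {Ω : Type*} [MeasurableSpace Ω] {P : Measure Ω} {H : ℝ} {B : ℝ≥0 → Ω → ℝ}

theorem isGaussianProcess_lamperti (hB : IsFractionalBrownianMotion H B P) :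
    IsGaussianProcess (lamperti H B) P :=
  (hB.isGaussianProcess.comp_right dyadicTime).smul fun k => (dyadicTime k : ℝ) ^ (-H)

theorem integral_lamperti (hB : IsFractionalBrownianMotion H B P) (k : ℕ) :
    ∫ ω, lamperti H B k ω ∂P = 0 := by
  simp only [lamperti]
  rw [integral_const_mul, hB.mean_eq_zero, mul_zero]

theorem covariance_lamperti (hB : IsFractionalBrownianMotion H B P) (j m : ℕ) :
    cov[lamperti H B j, lamperti H B (j + m); P] = fbmCorrelation H (2⁻¹ ^ m) := by
  unfold lamperti
  rw [covariance_const_mul_left, covariance_const_mul_right, hB.covariance_eq]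
  have hadd : (dyadicTime (j + m) : ℝ) = dyadicTime j * 2⁻¹ ^ m := by
    simp [dyadicTime, pow_add]
  rw [hadd]
  exact rescaled_covariance_eq (coe_dyadicTime_pos j) (by positivity)
    (pow_le_one₀ (by positivity) (by norm_num))

theorem ae_infinite_sign_changes_dyadicTime (hB : IsFractionalBrownianMotion H B P)
    (hH : H ∈ Set.Ioo (1 / 2 : ℝ) 1) :
    ∀ᵐ ω ∂P, {k | ¬ (0 < B (dyadicTime k) ω ↔ 0 < B (dyadicTime (k + 1)) ω)}.Infinite := by
  have hlim : Tendsto (fun m : ℕ => fbmCorrelation H (2⁻¹ ^ m)) atTop (𝓝 0) := by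
    refine (tendsto_fbmCorrelation_zero hH).comp (tendsto_nhdsWithin_iff.2
      ⟨tendsto_pow_atTop_nhds_zero_of_lt_one (by positivity) (by norm_num), ?_⟩)
    exact Eventually.of_forall fun m => by simp
  have h := ae_infinite_sign_changes hB.isGaussianProcess_lamperti hB.integral_lamperti
    hB.covariance_lamperti (by rw [pow_zero, fbmCorrelation_one (by linarith [hH.1])]) hlim
  simpa only [lamperti_pos_iff] using h

/-- By self-similarity the increments of `1(B > 0)` along the times `2⁻ᵏ` all have the same
distribution. -/
theorem identDistrib_positivityProcess_sub (hB : IsFractionalBrownianMotion H B P) (k : ℕ) :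
    IdentDistrib
      (positivityProcess B (dyadicTime k) - positivityProcess B (dyadicTime (k + 1)))
      (positivityProcess B (dyadicTime 0) - positivityProcess B (dyadicTime 1)) P P := by
  have hZ := hB.isGaussianProcess_lamperti
  have hvar (i : ℕ) : cov[lamperti H B i, lamperti H B i; P] = fbmCorrelation H 1 := by
    simpa using hB.covariance_lamperti i 0
  have hid : IdentDistrib (fun ω => (lamperti H B k ω, lamperti H B (k + 1) ω))
      (fun ω => (lamperti H B 0 ω, lamperti H B 1 ω)) P P :=
    ⟨hZ.hasGaussianLaw_prodMk.aemeasurable, hZ.hasGaussianLaw_prodMk.aemeasurable,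
      map_prodMk_eq_of_covariance_eq hZ.hasGaussianLaw_prodMk hZ.hasGaussianLaw_prodMk
        (by simp only [hB.integral_lamperti]) (by simp only [hB.integral_lamperti])
        (by simp only [hvar])
        ((hB.covariance_lamperti k 1).trans (hB.covariance_lamperti 0 1).symm)
        (by simp only [hvar])⟩
  have hind : Measurable ({x : ℝ | 0 < x}.indicator fun _ => (1 : ℝ)) :=
    measurable_const.indicator measurableSet_Ioi
  have hpos (i : ℕ) (ω : Ω) : positivityProcess B (dyadicTime i) ω =
      {x : ℝ | 0 < x}.indicator (fun _ => (1 : ℝ)) (lamperti H B i ω) := by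
    simp only [positivityProcess, Set.indicator, Set.mem_ofPred_eq, lamperti_pos_iff]
  have h := hid.comp ((hind.comp measurable_fst).sub (hind.comp measurable_snd))
  convert h using 1
  · ext ω
    simp [hpos]
  · ext ω
    simp [hpos]

end IsFractionalBrownianMotion

/-! ### Variation along dyadic partitions -/

theorem strictAnti_dyadicTime : StrictAnti dyadicTime :=
  pow_right_strictAnti₀ (by positivity) (by norm_num)

/-- The supremum of the sums of `G (t i) (t (i - 1))` over the partitions `t` of `[0, 1]` is at
least the sum of `G` over all consecutive dyadic times. -/
theorem tsum_dyadicTime_le_iSup_isPartition (G : ℝ≥0 → ℝ≥0 → ℝ≥0∞) :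
    ∑' k, G (dyadicTime k) (dyadicTime (k + 1)) ≤
      ⨆ (n : ℕ) (t : Fin (n + 1) → ℝ≥0) (_ : IsPartition 0 1 n t),
        ∑ i : Fin n, G (t i.succ) (t i.castSucc) := by
  rw [ENNReal.tsum_eq_iSup_nat]
  refine iSup_le fun n => ?_
  -- the partition `0 < 2⁻ⁿ < ... < 2⁻¹ < 1`
  let t : Fin (n + 1 + 1) → ℝ≥0 := Fin.cons 0 fun i => dyadicTime (n - i)
  have hpart : IsPartition 0 1 (n + 1) t := by
    refine ⟨?_, rfl, ?_⟩
    · refine Fin.strictMono_iff_lt_succ.2 fun i => ?_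
      refine Fin.cases ?_ (fun i => ?_) i
      · exact coe_dyadicTime_pos _
      · rw [← Fin.succ_castSucc]
        simp only [t, Fin.cons_succ]
        refine strictAnti_dyadicTime ?_
        simp only [Fin.val_succ, Fin.val_castSucc]
        omega
    · rw [← Fin.succ_last]
      simp [t, dyadicTime]
  refine le_iSup_of_le (n + 1) (le_iSup_of_le t (le_iSup_of_le hpart ?_))
  rw [Fin.sum_univ_succ]
  refine le_add_left (le_of_eq ?_)
  have hterm (i : Fin n) : G (t i.succ.succ) (t i.succ.castSucc) =
      (fun k : ℕ => G (dyadicTime (n - 1 - k)) (dyadicTime (n - 1 - k + 1))) i := by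
    rw [← Fin.succ_castSucc]
    simp only [t, Fin.cons_succ, Fin.val_succ, Fin.val_castSucc]
    congr 2 <;> omega
  rw [Finset.sum_congr rfl fun i _ => hterm i, Fin.sum_univ_eq_sum_range
    (fun k : ℕ => G (dyadicTime (n - 1 - k)) (dyadicTime (n - 1 - k + 1))),
    Finset.sum_range_reflect (fun k => G (dyadicTime k) (dyadicTime (k + 1)))]

theorem tsum_eq_top_of_infinite_setOf_le {ι : Type*} {a : ι → ℝ≥0∞} {c : ℝ≥0∞} (hc : c ≠ 0)
    (h : {i | c ≤ a i}.Infinite) : ∑' i, a i = ∞ := by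
  by_contra hne
  exact h (ENNReal.finite_const_le_of_tsum_ne_top hne hc)

theorem VariationClass.pos {φ : ℝ≥0 → ℝ≥0} (hφ : φ ∈ VariationClass) {x : ℝ≥0} (hx : 0 < x) :
    0 < φ x :=
  (zero_le (a := φ 0)).trans_lt (hφ.2.1 hx)

theorem VariationClass.extendTop_ne_zero {φ : ℝ≥0 → ℝ≥0} (hφ : φ ∈ VariationClass) {x : ℝ≥0∞}
    (hx : x ≠ 0) : extendTop φ x ≠ 0 := by
  unfold extendTop
  split_ifs with h
  · exact ENNReal.top_ne_zero
  · exact ENNReal.coe_ne_zero.2 (VariationClass.pos hφ (ENNReal.toNNReal_pos hx h)).ne'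

theorem positivityProcess_eq_iff {Ω : Type*} (B : ℝ≥0 → Ω → ℝ) (s t : ℝ≥0) (ω : Ω) :
    positivityProcess B s ω = positivityProcess B t ω ↔ (0 < B s ω ↔ 0 < B t ω) := by
  by_cases hs : 0 < B s ω <;> by_cases ht : 0 < B t ω <;> simp [positivityProcess, hs, ht]

theorem nnnorm_positivityProcess_sub {Ω : Type*} (B : ℝ≥0 → Ω → ℝ) {s t : ℝ≥0} {ω : Ω}
    (h : ¬ (0 < B s ω ↔ 0 < B t ω)) :
    ‖ positivityProcess B s ω - positivityProcess B t ω‖₊ = 1 := by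
  by_cases hs : 0 < B s ω <;> by_cases ht : 0 < B t ω <;>
    simp [positivityProcess, hs, ht] at h ⊢

theorem proposition2 {Ω : Type*} [MeasurableSpace Ω] (P : Measure Ω) [IsProbabilityMeasure P]
    (H : ℝ) (hH : H ∈ Set.Ioo (1 / 2 : ℝ) 1)
    (B : ℝ≥0 → Ω → ℝ) (hB : IsFractionalBrownianMotion H B P)
    (φ : ℝ≥0 → ℝ≥0) (hφ : φ ∈ VariationClass) :
    (∀ᵐ ω ∂P, phiVariation φ (fun t => positivityProcess B t ω) 0 1 = ∞) ∧
    (∀ (L : Submodule ℝ (Ω → ℝ)) (N : (Ω → ℝ) → ℝ≥0∞), IsLawInvariantNorm P L N →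
      (∀ t ∈ Set.Icc (0 : ℝ≥0) 1, positivityProcess B t ∈ L) →
      phiVariationIn φ N (positivityProcess B) 0 1 = ∞) := by
  have hsign := hB.ae_infinite_sign_changes_dyadicTime hH
  refine ⟨?_, fun L N hN hL => ?_⟩
  · filter_upwards [hsign] with ω hω
    have hle := tsum_dyadicTime_le_iSup_isPartition fun a b =>
      (φ ‖ positivityProcess B a ω - positivityProcess B b ω‖₊ : ℝ≥0∞)
    refine top_unique (le_of_eq_of_le (Eq.symm ?_) hle)
    refine tsum_eq_top_of_infinite_setOf_le (c := φ 1)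
      (ENNReal.coe_ne_zero.2 (VariationClass.pos hφ one_pos).ne') (hω.mono fun k hk => ?_)
    rw [Set.mem_ofPred_eq, nnnorm_positivityProcess_sub B hk]
  · set D : ℕ → Ω → ℝ := fun k =>
      positivityProcess B (dyadicTime k) - positivityProcess B (dyadicTime (k + 1)) with hD
    have hmem (k : ℕ) : D k ∈ L :=
      L.sub_mem (hL _ ⟨zero_le, dyadicTime_le_one _⟩) (hL _ ⟨zero_le, dyadicTime_le_one _⟩)
    have hconst (k : ℕ) : N (D k) = N (D 0) :=
      hN.eq_of_identDistrib _ (hmem k) _ (hmem 0) (hB.identDistrib_positivityProcess_sub k)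
    have hne : N (D 0) ≠ 0 := by
      intro h0
      -- all the dyadic increments would vanish almost surely, so that there is no sign change
      have hzero : ∀ᵐ ω ∂P, ∀ k, D k ω = 0 :=
        ae_all_iff.2 fun k => (hN.eq_zero_iff _ (hmem k)).1 ((hconst k).trans h0)
      obtain ⟨ω, hω, hω0⟩ := (hsign.and hzero).exists
      obtain ⟨k, hk⟩ := hω.nonempty
      exact hk ((positivityProcess_eq_iff B _ _ ω).1 (sub_eq_zero.1 (hω0 k)))
    have hle := tsum_dyadicTime_le_iSup_isPartition fun a b =>
      extendTop φ (N (positivityProcess B a - positivityProcess B b))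
    refine top_unique (le_of_eq_of_le (Eq.symm ?_) hle)
    refine tsum_eq_top_of_infinite_setOf_le (VariationClass.extendTop_ne_zero hφ hne) ?_
    have huniv : {k | extendTop φ (N (D 0)) ≤ extendTop φ (N (D k))} = Set.univ :=
      Set.eq_univ_of_forall fun k => by rw [Set.mem_ofPred_eq, hconst k]
    exact huniv ▸ Set.infinite_univ
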